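/- Let $G$ be an abelian group with $|G|\le 2^{\mathfrak c}$, where $\mathfrak c=|\mathbb R|$. For $n\in\mathbb N=\{0,1,2,\dots\}$ write $G[n]=\{x\in G: nx=0\}$. A subset $X$ of $G$ is called potentially dense in $G$ if $G$ admits a Hausdorff group topology in which $X$ is dense. A group topology on $G$ is precompact if the completion of $G$ with respect to it is compact. The group $G$ is almost torsion-free if for every prime $p$ its $p$-rank $\dim_{\mathbb Z/p\mathbb Z} G[p]$ is finite. The Zariski topology $\mathfrak Z_G$ is the topology on $G$ whose closed sets are the arbitrary intersections of finite unions of sets of the form $g+G[n]$ with $g\in G$ and $n\in\mathbb N$ (the empty union is $\emptyset$ and the empty intersection is $G$). Then the following conditions are equivalent: (i) every infinite subset of $G$ is potentially dense in $G$; (ii) for every infinite subset $X$ of $G$ there is a precompact Hausdorff group topology $\mathcal T$ on $G$ such that $X$ is $\mathcal T$-dense in $G$; (iii) $G$ is almost torsion-free or has exponent $p$ for some prime number $p$; (iv) every $\mathfrak Z_G$-closed proper subset of $G$ is finite. -/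

import Mathlib

open scoped Cardinal Topology

/-- An elementary algebraic subset of an abelian group: a set `g + G[n]` with `g ∈ G`, `n ∈ ℕ`
(so `n = 0` is allowed, and `G[0] = G`). -/
def IsElementaryAlgebraic {G : Type*} [AddCommGroup G] (E : Set G) : Prop :=
  ∃ (g : G) (n : ℕ), E = (fun t : G => g + t) '' {x : G | n • x = 0}

/-- A finite (possibly empty) union of elementary algebraic sets. -/
def IsAdditivelyAlgebraic {G : Type*} [AddCommGroup G] (A : Set G) : Prop :=
  ∃ 𝓔 : Set (Set G), 𝓔.Finite ∧ (∀ E ∈ 𝓔, IsElementaryAlgebraic E) ∧ A = ⋃₀ 𝓔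

/-- An algebraic set: an arbitrary intersection of finite unions of elementary algebraic sets.
The empty intersection is `G`. -/
def IsAlgebraicSet {G : Type*} [AddCommGroup G] (S : Set G) : Prop :=
  ∃ 𝓐 : Set (Set G), (∀ A ∈ 𝓐, IsAdditivelyAlgebraic A) ∧ S = ⋂₀ 𝓐

theorem IsAdditivelyAlgebraic.union {G : Type*} [AddCommGroup G] {A B : Set G}
    (hA : IsAdditivelyAlgebraic A) (hB : IsAdditivelyAlgebraic B) :
    IsAdditivelyAlgebraic (A ∪ B) := by
  obtain ⟨𝓔, h𝓔, h, rfl⟩ := hA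
  obtain ⟨𝓕, h𝓕, h', rfl⟩ := hB
  exact ⟨𝓔 ∪ 𝓕, h𝓔.union h𝓕, fun E hE => hE.elim (h E) (h' E), (Set.sUnion_union _ _).symm⟩

theorem isAlgebraicSet_empty {G : Type*} [AddCommGroup G] : IsAlgebraicSet (∅ : Set G) := by
  refine ⟨{∅}, ?_, by simp⟩
  rintro A rfl
  exact ⟨∅, Set.finite_empty, by simp, by simp⟩

theorem isAlgebraicSet_sInter {G : Type*} [AddCommGroup G] (𝓢 : Set (Set G))
    (h : ∀ S ∈ 𝓢, IsAlgebraicSet S) : IsAlgebraicSet (⋂₀ 𝓢) := by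
  refine ⟨{A | IsAdditivelyAlgebraic A ∧ ⋂₀ 𝓢 ⊆ A}, fun A hA => hA.1, ?_⟩
  refine Set.Subset.antisymm (fun x hx A hA => hA.2 hx) fun x hx S hS => ?_
  obtain ⟨𝓐, h𝓐, rfl⟩ := h S hS
  exact fun A hA => hx A ⟨h𝓐 A hA, fun y hy => hy _ hS A hA⟩

theorem IsAlgebraicSet.union {G : Type*} [AddCommGroup G] {S T : Set G}
    (hS : IsAlgebraicSet S) (hT : IsAlgebraicSet T) : IsAlgebraicSet (S ∪ T) := by
  obtain ⟨𝓐, h𝓐, rfl⟩ := hS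
  obtain ⟨𝓑, h𝓑, rfl⟩ := hT
  refine ⟨{C | ∃ A ∈ 𝓐, ∃ B ∈ 𝓑, C = A ∪ B}, ?_, ?_⟩
  · rintro C ⟨A, hA, B, hB, rfl⟩
    exact (h𝓐 A hA).union (h𝓑 B hB)
  · ext x
    constructor
    · rintro (hx | hx) C ⟨A, hA, B, hB, rfl⟩
      · exact Or.inl (hx A hA)
      · exact Or.inr (hx B hB)
    · intro hx
      by_contra hn
      simp only [Set.mem_union, Set.mem_sInter, not_or, not_forall] at hn
      obtain ⟨⟨A, hA, hxA⟩, B, hB, hxB⟩ := hn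
      exact (hx _ ⟨A, hA, B, hB, rfl⟩).elim hxA hxB

/-- The Zariski topology of an abelian group: its closed sets are the algebraic sets. -/
abbrev zariskiTopology (G : Type*) [AddCommGroup G] : TopologicalSpace G :=
  TopologicalSpace.ofClosed {S : Set G | IsAlgebraicSet S} isAlgebraicSet_empty
    isAlgebraicSet_sInter (fun _ hA _ hB => IsAlgebraicSet.union hA hB)

theorem isClosed_zariskiTopology_iff {G : Type*} [AddCommGroup G] (S : Set G) :
    IsClosed[zariskiTopology G] S ↔ IsAlgebraicSet S := by
  rw [← @isOpen_compl_iff G S (zariskiTopology G)]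
  change IsAlgebraicSet Sᶜᶜ ↔ _
  rw [compl_compl]

/-- A Hausdorff group topology on an abelian group. -/
structure IsHausdorffGroupTopology {G : Type*} [AddCommGroup G] (𝒯 : TopologicalSpace G) :
    Prop where
  isTopologicalAddGroup : @IsTopologicalAddGroup G 𝒯 _
  t2Space : @T2Space G 𝒯

/-- `X` is potentially dense in `G`: it is dense in some Hausdorff group topology on `G`. -/
def PotentiallyDense {G : Type*} [AddCommGroup G] (X : Set G) : Prop :=
  ∃ 𝒯 : TopologicalSpace G, IsHausdorffGroupTopology 𝒯 ∧ @Dense G 𝒯 X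

/-- A topological abelian group is precompact if its completion, with respect to its
translation-invariant uniformity, is compact. -/
def IsPrecompactAddGroup (G : Type*) [AddCommGroup G] [TopologicalSpace G]
    [IsTopologicalAddGroup G] : Prop :=
  letI : UniformSpace G := IsTopologicalAddGroup.rightUniformSpace G
  CompactSpace (UniformSpace.Completion G)

/-- A precompact Hausdorff group topology on an abelian group. -/
structure IsPrecompactHausdorffGroupTopology {G : Type*} [AddCommGroup G]
    (𝒯 : TopologicalSpace G) : Prop extends IsHausdorffGroupTopology 𝒯 where
  precompact : @IsPrecompactAddGroup G _ 𝒯 isTopologicalAddGroup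

/-- The `p`-rank of an abelian group, for a prime `p`: the dimension of `G[p]` over `ℤ/p`. -/
noncomputable def pRank (G : Type*) [AddCommGroup G] (p : ℕ) : Cardinal :=
  letI : Module (ZMod p) (AddSubgroup.torsionBy G (p : ℤ)) := AddSubgroup.torsionBy.zmodModule
  Module.rank (ZMod p) (AddSubgroup.torsionBy G (p : ℤ))

/-- An abelian group is almost torsion-free if all its `p`-ranks, `p` prime, are finite. -/
def IsAlmostTorsionFree (G : Type*) [AddCommGroup G] : Prop :=
  ∀ p : ℕ, p.Prime → pRank G p < ℵ₀

/-! ### Characters of abelian groups -/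

/-! The substance is (iii) ⇒ (ii). Write T for the circle. For infinite `X`, it suffices to find an
injective homomorphism `Φ` from `G` to a power of T with `Φ(G)` inside the closure of `Φ(X)`: the
induced topology is then precompact and Hausdorff, and `X` is dense in it
(`exists_isPrecompactHausdorffGroupTopology_dense`).

Density comes from a countable subgroup `A` containing infinitely many points of `X`. Let `K` be T,
or T[p] in exponent `p`. Some sequence `x n` in `X ∩ A` is so independent that every sequence in `K`
is, up to a null sequence, the values of a character of `A` along it (`exists_seq_interpolating`). A
power of `K` with at most continuum many factors is separable (`exists_seq_frequently_near`);
following a dense sequence coordinate by coordinate makes `Φ(x n)` come close to every point of that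
power.

For injectivity, countably many coordinates separate the points of `A`. Their common kernel `N` on
`G` meets `A` trivially, so the other coordinates are free on `N`. There `N` embeds in a vector
space over ℚ or ℤ/p, and since |G| ≤ 2^𝔠, continuum many characters separate its points
(`exists_separating_family_of_module`).

For (i) ⇒ (iv), Zariski closed sets are closed in every Hausdorff group topology; for (iv) ⇒ (iii),
apply (iv) to G[p]. -/

theorem baer_unitAddCircle : Module.Baer ℤ UnitAddCircle :=
  Module.Baer.of_divisible _

/-- The hypothesis says exactly that `x ↦ w` is well defined on the cyclic group of `x` (it is
vacuous for infinite order, where `addOrderOf x = 0`); injectivity of the circle extends it. -/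
theorem exists_addMonoidHom_apply_eq {A : Type*} [AddCommGroup A] (x : A) (w : UnitAddCircle)
    (h : addOrderOf x • w = 0) : ∃ ψ : A →+ UnitAddCircle, ψ x = w := by
  have H : ∀ c : ℤ, c • x = 0 → c • w = 0 := by
    intro c hc
    obtain ⟨k, rfl⟩ := addOrderOf_dvd_iff_zsmul_eq_zero.mpr hc
    rw [mul_comm, mul_smul, natCast_zsmul, h, smul_zero]
  obtain ⟨ψ, hψ⟩ := baer_unitAddCircle.extension_property
    (LinearPMap.mkSpanSingleton' (σ := RingHom.id ℤ) x w H).domain.subtype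
    (Submodule.injective_subtype _) (LinearPMap.mkSpanSingleton' (σ := RingHom.id ℤ) x w H).toFun
  refine ⟨ψ.toAddMonoidHom, ?_⟩
  have hx : x ∈ (LinearPMap.mkSpanSingleton' (σ := RingHom.id ℤ) x w H).domain := Submodule.mem_span_singleton_self x
  have h1 := LinearMap.congr_fun hψ ⟨x, hx⟩
  have h2 := LinearPMap.mkSpanSingleton'_apply_self (σ := RingHom.id ℤ) x w H hx
  exact h1.trans h2

theorem exists_addMonoidHom_eq_on {A : Type*} [AddCommGroup A] (L : AddSubgroup A)
    (φ : A →+ UnitAddCircle) (x : A) (w : UnitAddCircle)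
    (h : addOrderOf (x : A ⧸ L) • w = 0) :
    ∃ χ : A →+ UnitAddCircle, (∀ a ∈ L, χ a = φ a) ∧ χ x = φ x + w := by
  obtain ⟨ψ, hψ⟩ := exists_addMonoidHom_apply_eq (x : A ⧸ L) w h
  refine ⟨φ + ψ.comp (QuotientAddGroup.mk' L), fun a ha => ?_, ?_⟩
  · simp [(QuotientAddGroup.eq_zero_iff a).mpr ha]
  · simp [hψ]

theorem exists_addMonoidHom_ne_zero {A : Type*} [AddCommGroup A] {x : A} (hx : x ≠ 0) :
    ∃ ψ : A →+ UnitAddCircle, ψ x ≠ 0 := by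
  suffices ∃ w : UnitAddCircle, addOrderOf x • w = 0 ∧ w ≠ 0 by
    obtain ⟨w, h, hw⟩ := this
    obtain ⟨ψ, rfl⟩ := exists_addMonoidHom_apply_eq x w h
    exact ⟨ψ, hw⟩
  have key : ∀ n : ℕ, 1 < n → ∃ w : UnitAddCircle, n • w = 0 ∧ w ≠ 0 := by
    intro n hn
    have h := AddCircle.addOrderOf_period_div (p := (1 : ℝ)) (n := n) (by omega)
    refine ⟨((1 / n : ℝ) : UnitAddCircle), ?_, fun h0 => ?_⟩
    · have h' := addOrderOf_nsmul_eq_zero ((1 / n : ℝ) : UnitAddCircle)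
      rwa [h] at h'
    · rw [h0, addOrderOf_zero] at h
      omega
  rcases Nat.lt_trichotomy (addOrderOf x) 1 with h | h | h
  · obtain ⟨w, -, hw⟩ := key 2 one_lt_two
    exact ⟨w, by simp [Nat.lt_one_iff.mp h], hw⟩
  · exact absurd (AddMonoid.addOrderOf_eq_one_iff.mp h) hx
  · exact key _ h

theorem UnitAddCircle.exists_nsmul_eq_zero_norm_sub_le (u : UnitAddCircle) {n : ℕ} (hn : n ≠ 0) :
    ∃ w : UnitAddCircle, n • w = 0 ∧ ‖w - u‖ ≤ 1 / n := by
  obtain ⟨r, rfl⟩ := QuotientAddGroup.mk_surjective u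
  have hn' : (0 : ℝ) < n := by positivity
  refine ⟨((⌊r * n⌋ / n : ℝ) : UnitAddCircle), ?_, ?_⟩
  · rw [← AddCircle.coe_nsmul, nsmul_eq_mul, mul_div_cancel₀ _ hn'.ne']
    exact AddCircle.coe_eq_zero_iff (1 : ℝ) |>.mpr ⟨⌊r * n⌋, by simp⟩
  · have h : ‖((⌊r * n⌋ / n - r : ℝ) : UnitAddCircle)‖ ≤ |⌊r * n⌋ / n - r| := by
      rw [UnitAddCircle.norm_eq]
      simpa using round_le (⌊r * n⌋ / n - r) 0
    refine (le_of_eq (by rfl)).trans (h.trans ?_)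
    rw [abs_le]
    have h1 := Int.floor_le (r * n)
    have h2 := Int.lt_floor_add_one (r * n)
    constructor
    · rw [← sub_nonneg]
      have : ⌊r * n⌋ / n - r - -(1 / n) = (⌊r * n⌋ + 1 - r * n) / n := by field_simp; ring
      rw [this]; exact div_nonneg (by linarith) hn'.le
    · rw [← sub_nonneg]
      have : 1 / n - (⌊r * n⌋ / n - r) = (1 + r * n - ⌊r * n⌋) / n := by field_simp; ring
      rw [this]; exact div_nonneg (by linarith) hn'.le

theorem UnitAddCircle.norm_coe_le (r : ℝ) : ‖(r : UnitAddCircle)‖ ≤ |r| := by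
  rw [UnitAddCircle.norm_eq]
  simpa using round_le r 0

/-- Away from finitely many `x`, every character of `A` can be changed by at most `ε` on a given
finite set so that it takes at `x` a prescribed value from `K`, up to `ε`. -/
def IsSpreading (A : Type*) [AddCommGroup A] (K : AddSubgroup UnitAddCircle) : Prop :=
  ∀ (F : Finset A) (ε : ℝ), 0 < ε →
    {x : A | ¬ ∀ (φ : A →+ UnitAddCircle), ∀ u ∈ K, ∃ χ : A →+ UnitAddCircle,
      (∀ a ∈ F, ‖χ a - φ a‖ ≤ ε) ∧ ‖χ x - u‖ ≤ ε}.Finite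

/-- The exceptional points lie in the finite subgroup `L` generated by `F`. Outside it `x` has order
`p` modulo `L`, so a character of `A ⧸ L` corrects `φ x` by any element of T[p] without error. -/
theorem isSpreading_of_prime {A : Type*} [AddCommGroup A] {p : ℕ} (hp : p.Prime)
    (hA : ∀ x : A, p • x = 0) : IsSpreading A (nsmulAddMonoidHom p).ker := by
  intro F ε hε
  set L := AddSubgroup.closure (F : Set A)
  have hfin : (L : Set A).Finite := by
    have : AddGroup.FG L := by
      rw [AddGroup.fg_iff_addSubgroup_fg]; exact ⟨F, rfl⟩
    have ht : IsAddTorsion L := fun x =>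
      isOfFinAddOrder_iff_nsmul_eq_zero.mpr ⟨p, hp.pos, Subtype.ext (hA x)⟩
    have := AddCommGroup.finite_of_fg_isAddTorsion L ht
    exact Set.toFinite _
  refine hfin.subset fun x hx => ?_
  by_contra hxL
  refine hx fun φ u hu => ?_
  have hd : addOrderOf (x : A ⧸ L) = p := by
    refine addOrderOf_eq_prime_iff (hp := ⟨hp⟩) |>.mpr ⟨?_, fun h => hxL ?_⟩
    · rw [← QuotientAddGroup.mk_nsmul, hA, QuotientAddGroup.mk_zero]
    · exact (QuotientAddGroup.eq_zero_iff x).mp h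
  obtain ⟨χ, h1, h2⟩ := exists_addMonoidHom_eq_on L φ x (u - φ x) (by
    rw [hd, smul_sub, ← map_nsmul, hA, map_zero, sub_zero]; exact hu)
  refine ⟨χ, fun a ha => ?_, ?_⟩
  · rw [h1 a (AddSubgroup.subset_closure ha)]; simpa using hε.le
  · rw [h2]; simpa using hε.le

/-- In ℤⁿ ⊕ finite, only finitely many points have all integer coordinates bounded by `D`. If some
coordinate `q i x` is larger, the character `θ * q i` with `θ = r / q i x` hits `r` at `x` and is
small on `F`. -/
theorem finite_setOf_not_exists_small_of_fg (B : Type*) [AddCommGroup B] [AddGroup.FG B]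
    (F : Finset B) {ε : ℝ} (hε : 0 < ε) :
    {x : B | ¬ ∀ w : UnitAddCircle, ∃ ψ : B →+ UnitAddCircle,
      (∀ a ∈ F, ‖ψ a‖ ≤ ε) ∧ ψ x = w}.Finite := by
  obtain ⟨n, ι, _, p, hp, e, ⟨f⟩⟩ := AddCommGroup.equiv_free_prod_directSum_zmod B
  have hfinT : Finite (DirectSum ι fun i => ZMod (p i ^ e i)) := by
    have : ∀ i, NeZero (p i ^ e i) := fun i => ⟨pow_ne_zero _ (hp i).ne_zero⟩
    exact Finite.of_injective (fun g i => g i) fun _ _ h => DFinsupp.ext (congrFun h)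
  let q : Fin n → B →+ ℤ := fun i =>
    (Finsupp.applyAddHom i).comp ((AddMonoidHom.fst _ _).comp f.toAddMonoidHom)
  obtain ⟨C, hC⟩ : ∃ C : ℕ, ∀ i, ∀ a ∈ F, |q i a| ≤ C := by
    refine ⟨∑ i, ∑ a ∈ F, (q i a).natAbs, fun i a ha => ?_⟩
    rw [Int.abs_eq_natAbs]
    exact_mod_cast (Finset.single_le_sum (f := fun a => (q i a).natAbs)
      (fun _ _ => Nat.zero_le _) ha).trans
      (Finset.single_le_sum (f := fun i => ∑ a ∈ F, (q i a).natAbs)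
      (fun _ _ => Nat.zero_le _) (Finset.mem_univ i))
  obtain ⟨D, hD⟩ := exists_nat_gt (C / ε)
  have hfin : {x : B | ∀ i, |q i x| ≤ D}.Finite := by
    have h1 : (Set.univ.pi fun _ : Fin n => Set.Icc (-(D : ℤ)) D).Finite :=
      Set.Finite.pi fun _ => Set.finite_Icc _ _
    have h2 := (h1.prod (Set.finite_univ (α := DirectSum ι fun i => ZMod (p i ^ e i))))
    refine Set.Finite.of_injOn (f := fun x => ((fun i => q i x), (f x).2)) ?_ ?_ h2
    · intro x hx
      simp only [Set.mem_prod, Set.mem_univ, and_true]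
      exact fun i _ => abs_le.mp (hx i)
    · intro x _ y _ hxy
      simp only [Prod.mk.injEq] at hxy
      refine f.injective (Prod.ext (Finsupp.ext fun i => congrFun hxy.1 i) hxy.2)
  refine hfin.subset fun x hx => ?_
  by_contra hn
  simp only [Set.mem_ofPred_eq, not_forall, not_le] at hn
  obtain ⟨i, hi⟩ := hn
  refine hx fun w => ?_
  obtain ⟨r, hr, rfl⟩ := AddCircle.eq_coe_Ico w
  have hiR : (D : ℝ) < |(q i x : ℝ)| := by exact_mod_cast hi
  have hpos : 0 < |(q i x : ℝ)| := lt_of_le_of_lt (Nat.cast_nonneg D) hiR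
  let θ : ℝ := r / q i x
  refine ⟨((zmultiplesHom UnitAddCircle) (θ : UnitAddCircle)).comp (q i), fun a ha => ?_, ?_⟩
  · simp only [AddMonoidHom.comp_apply, zmultiplesHom_apply]
    rw [← AddCircle.coe_zsmul, zsmul_eq_mul]
    refine (UnitAddCircle.norm_coe_le _).trans ?_
    have h1 : |(q i a : ℝ)| ≤ C := by exact_mod_cast hC i a ha
    have h2 : |r| ≤ 1 := by rw [abs_of_nonneg hr.1]; exact hr.2.le
    simp only [θ]
    rw [abs_mul, abs_div, ← mul_div_assoc, div_le_iff₀ hpos]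
    rw [div_lt_iff₀ hε] at hD
    calc |(q i a : ℝ)| * |r| ≤ C * 1 := by gcongr
      _ ≤ D * ε := by linarith
      _ ≤ ε * |(q i x : ℝ)| := by rw [mul_comm]; gcongr
  · simp only [AddMonoidHom.comp_apply, zmultiplesHom_apply]
    rw [← AddCircle.coe_zsmul, zsmul_eq_mul]
    congr 1
    simp only [θ]
    exact mul_div_cancel₀ _ (abs_pos.mp hpos)

/-- Let `B` be the set of `x` with `N! • x ∈ L`, where `N > 1/ε`. Outside `B` the order of `x`
modulo `L` is infinite or exceeds `N`, so the admissible corrections are `ε`-dense in the circle.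
Finite torsion makes `B` finitely generated, which reduces the rest to the previous lemma. -/
theorem isSpreading_top_of_finite_torsion {A : Type*} [AddCommGroup A]
    (hA : ∀ m : ℕ, m ≠ 0 → {x : A | m • x = 0}.Finite) : IsSpreading A ⊤ := by
  intro F ε hε
  obtain ⟨N, hN⟩ := exists_nat_gt (1 / ε)
  have hm : N.factorial ≠ 0 := N.factorial_ne_zero
  set L := AddSubgroup.closure (F : Set A)
  let mul : A →+ A := nsmulAddMonoidHom N.factorial
  let B : AddSubgroup A := L.comap mul
  have hFB : ∀ a ∈ F, a ∈ B := fun a ha =>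
    L.nsmul_mem (AddSubgroup.subset_closure ha) _
  have hB : AddGroup.FG B := by
    rw [AddGroup.fg_iff_addSubgroup_fg]
    refine (Submodule.fg_iff_addSubgroup_fg (AddSubgroup.toIntSubmodule B)).mp ?_
    refine Submodule.fg_of_fg_map_of_fg_inf_ker mul.toIntLinearMap ?_ ?_
    · have hL : (AddSubgroup.toIntSubmodule L).FG :=
        (Submodule.fg_iff_addSubgroup_fg (AddSubgroup.toIntSubmodule L)).mpr ⟨F, rfl⟩
      have := isNoetherian_of_fg_of_noetherian _ hL
      refine Submodule.FG.of_le hL ?_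
      rintro _ ⟨b, hb, rfl⟩
      exact hb
    · have hk : ((AddSubgroup.toIntSubmodule B ⊓ LinearMap.ker mul.toIntLinearMap :
          Submodule ℤ A) : Set A).Finite :=
        (hA _ hm).subset fun x hx => hx.2
      exact ⟨hk.toFinset, by rw [Set.Finite.coe_toFinset, Submodule.span_eq]⟩
  have hbad := finite_setOf_not_exists_small_of_fg B (F.attach.map ⟨fun a => ⟨a.1, hFB _ a.2⟩,
    fun a b h => Subtype.ext (by simpa using h)⟩) hε
  refine (hbad.image Subtype.val).subset fun x hx => ?_
  by_contra hxn
  refine hx fun φ u _ => ?_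
  by_cases hxB : x ∈ B
  · have h := not_not.mp fun h => hxn ⟨⟨x, hxB⟩, h, rfl⟩
    obtain ⟨ψ, hψ, hψx⟩ := h (u - φ x)
    obtain ⟨ψ', hψ'⟩ := baer_unitAddCircle.extension_property_addMonoidHom B.subtype
      B.subtype_injective ψ
    have hext : ∀ b (hb : b ∈ B), ψ' b = ψ ⟨b, hb⟩ := fun b hb => DFunLike.congr_fun hψ' ⟨b, hb⟩
    refine ⟨φ + ψ', fun a ha => ?_, ?_⟩
    · simp only [AddMonoidHom.add_apply, add_sub_cancel_left, hext a (hFB a ha)]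
      exact hψ _ (Finset.mem_map.mpr ⟨⟨a, ha⟩, Finset.mem_attach _ _, rfl⟩)
    · simp only [AddMonoidHom.add_apply, hext x hxB, hψx]
      simpa using hε.le
  · obtain ⟨w, hw, hwu⟩ : ∃ w : UnitAddCircle,
        addOrderOf (x : A ⧸ L) • w = 0 ∧ ‖w - (u - φ x)‖ ≤ ε := by
      by_cases h0 : addOrderOf (x : A ⧸ L) = 0
      · exact ⟨u - φ x, by rw [h0, zero_smul], by simpa using hε.le⟩
      · obtain ⟨w, h1, h2⟩ := UnitAddCircle.exists_nsmul_eq_zero_norm_sub_le (u - φ x) h0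
        refine ⟨w, h1, h2.trans ?_⟩
        have hlt : N < addOrderOf (x : A ⧸ L) := by
          by_contra hle
          refine hxB ((QuotientAddGroup.eq_zero_iff (N := L) (N.factorial • x)).mp ?_)
          rw [QuotientAddGroup.mk_nsmul]
          exact addOrderOf_dvd_iff_nsmul_eq_zero.mp
            (Nat.dvd_factorial (Nat.pos_of_ne_zero h0) (not_lt.mp hle))
        have : (N : ℝ) < addOrderOf (x : A ⧸ L) := by exact_mod_cast hlt
        exact (one_div_le (by positivity) hε).mpr (hN.trans this).le
    obtain ⟨χ, h1, h2⟩ := exists_addMonoidHom_eq_on L φ x w hw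
    refine ⟨χ, fun a ha => ?_, ?_⟩
    · rw [h1 a (AddSubgroup.subset_closure ha)]; simpa using hε.le
    · rw [h2]; convert hwu using 2; abel

/-! ### Interpolation along a sequence -/

theorem exists_seq_increments_spreading {A : Type*} [AddCommGroup A] {K : AddSubgroup UnitAddCircle}
    (hA : IsSpreading A K) {X : Set A} (hX : X.Infinite) {a : ℕ → A}
    (ha : Function.Surjective a) :
    ∃ (x : ℕ → A) (F : ℕ → Set A), (∀ n, x n ∈ X) ∧ Monotone F ∧ (∀ n, a n ∈ F (n + 1)) ∧
      (∀ n, x n ∈ F (n + 1)) ∧ ∀ n (φ : A →+ UnitAddCircle), ∀ u ∈ K, ∃ χ : A →+ UnitAddCircle,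
        (∀ b ∈ F n, ‖χ b - φ b‖ ≤ (1 / 2) ^ n) ∧ ‖χ (x n) - u‖ ≤ (1 / 2) ^ n := by
  classical
  have step : ∀ n m : ℕ, ∃ j, a j ∈ X ∧ ∀ (φ : A →+ UnitAddCircle), ∀ u ∈ K,
      ∃ χ : A →+ UnitAddCircle, (∀ b ∈ (Finset.range m).image a, ‖χ b - φ b‖ ≤ (1 / 2) ^ n) ∧
        ‖χ (a j) - u‖ ≤ (1 / 2) ^ n := by
    intro n m
    obtain ⟨y, hy, hyn⟩ := (hX.sdiff
      (hA ((Finset.range m).image a) ((1 / 2) ^ n) (by positivity))).nonempty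
    obtain ⟨j, rfl⟩ := ha y
    exact ⟨j, hy, not_not.mp hyn⟩
  choose j hjX hj using step
  -- `F n` will be the first `M n` terms of the enumeration; `M` grows to absorb both `a n` and the
  -- chosen `x n`.
  let M : ℕ → ℕ := fun n => Nat.rec 0 (fun n m => max m (max (j n m + 1) (n + 1))) n
  have hM : ∀ n, M (n + 1) = max (M n) (max (j n (M n) + 1) (n + 1)) := fun _ => rfl
  refine ⟨fun n => a (j n (M n)), fun n => (Finset.range (M n)).image a, fun n => hjX _ _,
    monotone_nat_of_le_succ fun n => ?_, fun n => ?_, fun n => ?_, fun n => hj n (M n)⟩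
  · refine Finset.coe_subset.mpr ?_
    refine Finset.image_subset_image (Finset.range_subset_range.mpr ?_)
    rw [hM]; exact le_max_left _ _
  · refine Finset.mem_coe.mpr (Finset.mem_image_of_mem a (Finset.mem_range.mpr ?_))
    rw [hM]; omega
  · refine Finset.mem_coe.mpr (Finset.mem_image_of_mem a (Finset.mem_range.mpr ?_))
    rw [hM]; omega

/-- Starting from `φ` at stage `N`, correct the character at `x N`, `x (N + 1)`, and so on. Stage
`n` moves values on `F n` by at most `2⁻ⁿ`, so the characters converge pointwise, and later
corrections barely disturb the value already arranged at `x n`. -/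
theorem exists_seq_interpolating {A : Type*} [AddCommGroup A] [Countable A]
    {K : AddSubgroup UnitAddCircle} (hA : IsSpreading A K) {X : Set A} (hX : X.Infinite) :
    ∃ x : ℕ → A, (∀ n, x n ∈ X) ∧ ∀ (u : ℕ → K) (φ : A →+ UnitAddCircle) (a : A),
      ∃ χ : A →+ UnitAddCircle, (φ a ≠ 0 → χ a ≠ 0) ∧
        Filter.Tendsto (fun n => χ (x n) - (u n : UnitAddCircle)) Filter.atTop (𝓝 0) := by
  obtain ⟨a, ha⟩ := exists_surjective_nat A
  obtain ⟨x, F, hxX, hF, haF, hxF, hstep⟩ := exists_seq_increments_spreading hA hX ha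
  refine ⟨x, hxX, fun u φ b => ?_⟩
  choose next hnext hnextx using hstep
  have hmem : ∀ c, ∃ n, c ∈ F n := fun c => by
    obtain ⟨n, rfl⟩ := ha c
    exact ⟨n + 1, haF n⟩
  -- The total movement at `b` is at most `2 * 2⁻ᴺ`, too small to bring `φ b` to zero.
  obtain ⟨N, hbN, hN⟩ : ∃ N, b ∈ F N ∧ (φ b ≠ 0 → 2 * (1 / 2 : ℝ) ^ N < ‖φ b‖) := by
    obtain ⟨n₁, h₁⟩ := hmem b
    by_cases h0 : φ b = 0
    · exact ⟨n₁, h₁, fun h => absurd h0 h⟩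
    · obtain ⟨n₂, h₂⟩ := exists_pow_lt_of_lt_one (half_pos (norm_pos_iff.mpr h0))
        (one_half_lt_one (α := ℝ))
      refine ⟨max n₁ n₂, hF (le_max_left _ _) h₁, fun _ => ?_⟩
      have : (1 / 2 : ℝ) ^ max n₁ n₂ ≤ (1 / 2) ^ n₂ :=
        pow_le_pow_of_le_one (by norm_num) (by norm_num) (le_max_right _ _)
      linarith
  let ψ : ℕ → A →+ UnitAddCircle := fun k =>
    Nat.rec φ (fun k f => next (N + k) f (u (N + k)) (u (N + k)).2) k
  have hψ : ∀ k, ψ (k + 1) = next (N + k) (ψ k) (u (N + k)) (u (N + k)).2 := fun _ => rfl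
  have hdist : ∀ c m, c ∈ F (N + m) → ∀ k,
      dist (ψ (m + k) c) (ψ (m + (k + 1)) c) ≤ (1 / 2) ^ (N + m) * (1 / 2) ^ k := by
    intro c m hc k
    rw [dist_comm, dist_eq_norm, ← add_assoc, hψ, ← pow_add, add_assoc]
    exact hnext _ _ _ _ c (hF (by omega) hc)
  have hlim : ∀ c, ∃ l, Filter.Tendsto (fun k => ψ k c) Filter.atTop (𝓝 l) := by
    intro c
    obtain ⟨m, hm⟩ := hmem c
    have hcau := cauchySeq_of_le_geometric _ _ one_half_lt_one
      (hdist c m (hF (Nat.le_add_left _ _) hm))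
    obtain ⟨l, hl⟩ := cauchySeq_tendsto_of_complete hcau
    refine ⟨l, (Filter.tendsto_add_atTop_iff_nat m).mp ?_⟩
    simpa only [add_comm] using hl
  choose χ hχ using hlim
  let χ' : A →+ UnitAddCircle := addMonoidHomOfTendsto χ ψ (tendsto_pi_nhds.mpr hχ)
  have hbound : ∀ c m, c ∈ F (N + m) → dist (ψ m c) (χ c) ≤ 2 * (1 / 2) ^ (N + m) := by
    intro c m hc
    have hl : Filter.Tendsto (fun k => ψ (m + k) c) Filter.atTop (𝓝 (χ c)) := by
      have := (Filter.tendsto_add_atTop_iff_nat m).mpr (hχ c)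
      simpa only [add_comm] using this
    have := dist_le_of_le_geometric_of_tendsto₀ _ _ one_half_lt_one (hdist c m hc) hl
    refine this.trans (le_of_eq ?_)
    ring
  refine ⟨χ', fun h0 hb => ?_, ?_⟩
  · have h1 := hbound b 0 hbN
    have h2 : χ b = 0 := hb
    rw [h2, dist_zero_right] at h1
    exact absurd (hN h0) (not_lt.mpr h1)
  · have hz : Filter.Tendsto (fun n : ℕ => 2 * (1 / 2 : ℝ) ^ n) Filter.atTop (𝓝 0) := by
      simpa using (tendsto_pow_atTop_nhds_zero_of_lt_one (by norm_num)
        (one_half_lt_one (α := ℝ))).const_mul 2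
    refine squeeze_zero_norm' ?_ hz
    filter_upwards [Filter.eventually_ge_atTop N] with n hn
    obtain ⟨k, rfl⟩ := Nat.exists_eq_add_of_le hn
    have h1 := hbound (x (N + k)) (k + 1) (hxF (N + k))
    have h2 := hnextx (N + k) (ψ k) (u (N + k)) (u (N + k)).2
    rw [← hψ] at h2
    rw [dist_comm, dist_eq_norm] at h1
    calc ‖χ' (x (N + k)) - (u (N + k) : UnitAddCircle)‖
        = ‖(χ (x (N + k)) - ψ (k + 1) (x (N + k))) +
          (ψ (k + 1) (x (N + k)) - (u (N + k) : UnitAddCircle))‖ := by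
          rw [sub_add_sub_cancel]; rfl
      _ ≤ 2 * (1 / 2) ^ (N + (k + 1)) + (1 / 2) ^ (N + k) :=
          (norm_add_le _ _).trans (add_le_add h1 h2)
      _ = 2 * (1 / 2) ^ (N + k) := by rw [← add_assoc, pow_succ]; ring

/-! ### A dense sequence in a product of at most continuum many separable spaces -/

/-- The Hewitt–Marczewski–Pondiczery argument: `e` places the indices in Cantor space, and functions
of finitely many bits with values in a countable dense set form a countable dense family. -/
theorem exists_seq_frequently_near {ι Y : Type*} [PseudoMetricSpace Y]
    [TopologicalSpace.SeparableSpace Y] [Nonempty Y] {e : ι → ℕ → Bool}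
    (he : Function.Injective e) :
    ∃ y : ℕ → ι → Y, ∀ (s : Finset ι) (v : ι → Y) (ε : ℝ), 0 < ε →
      ∃ᶠ k in Filter.atTop, ∀ t ∈ s, dist (y k t) (v t) < ε := by
  obtain ⟨code, hcode⟩ := exists_surjective_nat (Σ n : ℕ, ((Fin n → Bool) → ℕ))
  let D : (Σ n : ℕ, ((Fin n → Bool) → ℕ)) → ι → Y := fun c t =>
    TopologicalSpace.denseSeq Y (c.2 fun i => e t i)
  let z : ℕ → ι → Y := fun k => D (code k)
  -- Unpairing repeats each `z k` infinitely often, which turns existence into `∃ᶠ`.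
  refine ⟨fun k => z k.unpair.1, fun s v ε hε => ?_⟩
  suffices h : ∃ k, ∀ t ∈ s, dist (z k t) (v t) < ε by
    obtain ⟨k, hk⟩ := h
    refine Filter.frequently_atTop.mpr fun m => ⟨Nat.pair k m, Nat.right_le_pair k m, ?_⟩
    simpa using hk
  obtain ⟨n, hn⟩ : ∃ n, Set.InjOn (fun (t : ι) (i : Fin n) => e t i) s := by
    have h : ∀ p : ι × ι, ∃ n, p.1 ≠ p.2 → e p.1 n ≠ e p.2 n := by
      intro p
      by_cases hp : p.1 = p.2
      · exact ⟨0, fun h => absurd hp h⟩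
      · obtain ⟨n, hn⟩ := Function.ne_iff.mp (he.ne hp)
        exact ⟨n, fun _ => hn⟩
    choose n hn using h
    refine ⟨(s ×ˢ s).sup n + 1, fun t ht t' ht' hEq => ?_⟩
    by_contra hne
    have hle : n (t, t') ≤ (s ×ˢ s).sup n :=
      Finset.le_sup (f := n) (Finset.mk_mem_product ht ht')
    exact hn (t, t') hne (congrFun hEq ⟨n (t, t'), by omega⟩)
  have hd : ∀ w : Y, ∃ m, dist (TopologicalSpace.denseSeq Y m) w < ε := fun w => by
    obtain ⟨m, hm⟩ := (TopologicalSpace.denseRange_denseSeq Y).exists_dist_lt w hε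
    exact ⟨m, by rwa [dist_comm]⟩
  choose d hd using hd
  classical
  let c : (Fin n → Bool) → ℕ := fun b =>
    if h : ∃ t ∈ s, (fun i : Fin n => e t i) = b then d (v h.choose) else 0
  obtain ⟨k, hk⟩ := hcode ⟨n, c⟩
  refine ⟨k, fun t ht => ?_⟩
  have hex : ∃ t' ∈ s, (fun i : Fin n => e t' i) = fun i : Fin n => e t i := ⟨t, ht, rfl⟩
  have hc : c (fun i => e t i) = d (v t) := by
    have h1 : hex.choose = t := hn hex.choose_spec.1 ht hex.choose_spec.2
    simp only [c, dif_pos hex, h1]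
  have : z k t = TopologicalSpace.denseSeq Y (c fun i => e t i) := by
    simp only [z]
    rw [hk]
  rw [this, hc]
  exact hd _

/-! ### Continuum many characters separating points -/

/-- Label basis vectors by distinct sets of reals. The functional for `(F, E)` is 1 on basis vectors
whose label agrees with `E` on `F`, and 0 on the others. For a nonzero vector, a finite `F` telling
one label in its support from the others isolates that coordinate. -/
theorem exists_separating_family_of_module {N k V : Type*} [AddCommGroup N] [Field k]
    [AddCommGroup V] [Module k V] {j : N →+ V} (hj : Function.Injective j)
    {e : k →+ UnitAddCircle} (he : Function.Injective e) (hV : #V ≤ 2 ^ 𝔠) :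
    ∃ ψ : Finset ℝ × Finset ℝ → (N →+ UnitAddCircle), ∀ g, g ≠ 0 → ∃ i, ψ i g ≠ 0 := by
  classical
  let b := Module.Basis.ofVectorSpace k V
  obtain ⟨s⟩ : Nonempty (Module.Basis.ofVectorSpaceIndex k V ↪ Set ℝ) := by
    rw [← Cardinal.lift_mk_le']
    have h1 := (Cardinal.mk_set_le (Module.Basis.ofVectorSpaceIndex k V)).trans hV
    have h2 := Cardinal.lift_le.{0}.mpr h1
    simpa [Cardinal.mk_set, Cardinal.mk_real] using h2
  let f : Finset ℝ × Finset ℝ → V →ₗ[k] k := fun P =>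
    b.constr ℕ fun i => if ∀ r ∈ P.1, r ∈ s i ↔ r ∈ P.2 then 1 else 0
  refine ⟨fun P => e.comp ((f P).toAddMonoidHom.comp j), fun g hg => ?_⟩
  have hv : b.repr (j g) ≠ 0 := by
    simpa using (map_ne_zero_iff j hj).mpr hg
  obtain ⟨i₀, hi₀⟩ := Finsupp.ne_iff.mp hv
  have hsep : ∀ i, ∃ r, i ≠ i₀ → ¬ (r ∈ s i ↔ r ∈ s i₀) := by
    intro i
    by_cases hi : i = i₀
    · exact ⟨0, fun h => absurd hi h⟩
    · have h := s.injective.ne hi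
      rw [Ne, Set.ext_iff, not_forall] at h
      exact h.imp fun r hr _ => hr
  choose r hr using hsep
  let F := (b.repr (j g)).support.image r
  refine ⟨(F, F.filter (· ∈ s i₀)), ?_⟩
  have hval : f (F, F.filter (· ∈ s i₀)) (j g) = b.repr (j g) i₀ := by
    simp only [f, Module.Basis.constr_apply]
    rw [Finsupp.sum, Finset.sum_eq_single i₀]
    · rw [if_pos, smul_eq_mul, mul_one]
      intro x hx
      simp [hx]
    · intro i hi hne
      rw [if_neg, smul_zero]
      intro h
      have hrF : r i ∈ F := Finset.mem_image_of_mem r hi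
      exact hr i hne ((h _ hrF).trans (by simp [hrF]))
    · intro h
      rw [Finsupp.notMem_support_iff.mp h, zero_smul]
  simp only [AddMonoidHom.comp_apply, LinearMap.toAddMonoidHom_coe, hval]
  exact (map_ne_zero_iff e he).mpr hi₀

theorem exists_separating_family_of_prime {N : Type*} [AddCommGroup N] {p : ℕ} (hp : p.Prime)
    (hN : ∀ x : N, p • x = 0) (hc : #N ≤ 2 ^ 𝔠) :
    ∃ ψ : Finset ℝ × Finset ℝ → (N →+ UnitAddCircle), ∀ g, g ≠ 0 → ∃ i, ψ i g ≠ 0 := by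
  have : Fact p.Prime := ⟨hp⟩
  let _ : Module (ZMod p) N := AddCommGroup.zmodModule hN
  exact exists_separating_family_of_module (k := ZMod p) (j := AddMonoidHom.id N)
    Function.injective_id (e := ZMod.toAddCircle) (ZMod.toAddCircle_injective p) hc

/-- Multiply by an irrational number and reduce modulo 1. -/
theorem exists_injective_rat_unitAddCircle :
    ∃ e : ℚ →+ UnitAddCircle, Function.Injective e := by
  obtain ⟨α, hα⟩ : ∃ α : ℝ, Irrational α := ⟨_, irrational_sqrt_two⟩
  let e : ℚ →+ UnitAddCircle := (QuotientAddGroup.mk' _).comp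
    ((AddMonoidHom.mulRight α).comp (Rat.castHom ℝ).toAddMonoidHom)
  refine ⟨e, (injective_iff_map_eq_zero e).mpr fun q hq => ?_⟩
  obtain ⟨n, hn⟩ := AddCircle.coe_eq_zero_iff (1 : ℝ) |>.mp
    (show ((q * α : ℝ) : UnitAddCircle) = 0 from hq)
  by_contra h0
  have h0' : (q : ℝ) ≠ 0 := by exact_mod_cast h0
  refine hα ⟨n / q, ?_⟩
  push_cast
  rw [div_eq_iff h0', mul_comm, ← hn]
  simp

theorem exists_separating_family_of_torsionFree {N : Type*} [AddCommGroup N]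
    (hN : ∀ (n : ℕ) (x : N), n ≠ 0 → n • x = 0 → x = 0) (hc : #N ≤ 2 ^ 𝔠) :
    ∃ ψ : Finset ℝ × Finset ℝ → (N →+ UnitAddCircle), ∀ g, g ≠ 0 → ∃ i, ψ i g ≠ 0 := by
  obtain ⟨e, he⟩ := exists_injective_rat_unitAddCircle
  refine exists_separating_family_of_module (V := DivisibleHull N)
    (j := DivisibleHull.coeAddMonoidHom N) ?_ he ?_
  · refine (injective_iff_map_eq_zero _).mpr fun x hx => ?_
    have h : DivisibleHull.mk x 1 = DivisibleHull.mk 0 1 := by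
      rw [DivisibleHull.mk_zero]; exact hx
    obtain ⟨u, hu⟩ := DivisibleHull.mk_eq_mk.mp h
    exact hN u x u.ne_zero (by simpa using hu)
  · have hsurj : Function.Surjective fun p : N × ℕ+ => DivisibleHull.mk p.1 p.2 := by
      intro v
      induction v with
      | mk n d => exact ⟨(n, d), rfl⟩
    refine (Cardinal.mk_le_of_surjective hsurj).trans ?_
    have h0 : ℵ₀ ≤ (2 : Cardinal) ^ 𝔠 := Cardinal.aleph0_le_continuum.trans (Cardinal.cantor _).le
    rw [Cardinal.mk_prod, Cardinal.lift_uzero]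
    refine (mul_le_mul' hc ?_).trans (Cardinal.mul_eq_self h0).le
    simpa using h0

theorem AddSubgroup.countable_closure {G : Type*} [AddCommGroup G] {S : Set G} (hS : S.Countable) :
    Countable (AddSubgroup.closure S) := by
  have := hS.to_subtype
  refine ((Set.countable_range
    (Finsupp.linearCombination ℤ (Subtype.val : S → G))).mono fun x hx => ?_).to_subtype
  have hle : AddSubgroup.closure S ≤
      (Finsupp.linearCombination ℤ (Subtype.val : S → G)).toAddMonoidHom.range :=
    (AddSubgroup.closure_le _).mpr fun s hs => ⟨Finsupp.single ⟨s, hs⟩ 1, by simp⟩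
  exact hle hx

theorem Set.Infinite.exists_infinite_countable_subset {α : Type*} {X : Set α} (hX : X.Infinite) :
    ∃ S ⊆ X, S.Infinite ∧ S.Countable :=
  ⟨Set.range fun n => (hX.natEmbedding _ n : α), by rintro _ ⟨n, rfl⟩; exact (hX.natEmbedding _ n).2,
    Set.infinite_range_of_injective (Subtype.val_injective.comp (hX.natEmbedding _).injective),
    Set.countable_range _⟩

/-! ### Embedding into a power of the circle with dense image of a given set -/

theorem exists_injective_nat_bool_sum :
    ∃ e : ℕ ⊕ (Finset ℝ × Finset ℝ) → ℕ → Bool, Function.Injective e := by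
  have h : #(ℕ ⊕ (Finset ℝ × Finset ℝ)) ≤ #(ℕ → Bool) := by
    simp [Cardinal.mk_finset_of_infinite, Cardinal.mk_real]
  obtain ⟨e⟩ := Cardinal.le_def _ _ |>.mp h
  exact ⟨e, e.injective⟩

/-- Coordinates `inl n` separate the points of `A`, coordinates `inr i` those of the common kernel
`N` of the former; all of them follow the dense sequence `y` along `x`. By `hK`, the points `Φ g`
lie in the power of `K` that `y` approximates. -/
theorem exists_injective_hom_closure {G : Type*} [AddCommGroup G] {K : AddSubgroup UnitAddCircle}
    (hK : ∀ (φ : G →+ UnitAddCircle) (g : G), φ g ∈ K) {X : Set G} {A : AddSubgroup G}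
    [Countable A] (hA : IsSpreading A K) (hX : (X ∩ A).Infinite)
    (hsep : ∀ N : AddSubgroup G, Disjoint A N → ∃ ψ : Finset ℝ × Finset ℝ → (N →+ UnitAddCircle),
      ∀ g, g ≠ 0 → ∃ i, ψ i g ≠ 0) :
    ∃ Φ : G →+ (ℕ ⊕ (Finset ℝ × Finset ℝ) → UnitAddCircle),
      Function.Injective Φ ∧ ∀ g, Φ g ∈ closure (Φ '' X) := by
  obtain ⟨a, ha⟩ := exists_surjective_nat A
  obtain ⟨x, hxX, hx⟩ := exists_seq_interpolating hA (X := Subtype.val ⁻¹' X) <| by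
    refine Set.Infinite.of_image Subtype.val ?_
    exact hX.mono fun g hg => ⟨⟨g, hg.2⟩, hg.1, rfl⟩
  obtain ⟨e, he⟩ := exists_injective_nat_bool_sum
  obtain ⟨y, hy⟩ := exists_seq_frequently_near (Y := K) he
  have hchar : ∀ t, ∃ χ : A →+ UnitAddCircle, (∀ n, t = Sum.inl n → a n ≠ 0 → χ (a n) ≠ 0) ∧
      Filter.Tendsto (fun n => χ (x n) - (y n t : UnitAddCircle)) Filter.atTop (𝓝 0) := by
    rintro (n | i)
    · by_cases hn : a n = 0
      · obtain ⟨χ, -, h⟩ := hx (fun k => y k (Sum.inl n)) 0 0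
        exact ⟨χ, by rintro _ ⟨⟩ h0; exact absurd hn h0, h⟩
      · obtain ⟨φ, hφ⟩ := exists_addMonoidHom_ne_zero hn
        obtain ⟨χ, h0, h⟩ := hx (fun k => y k (Sum.inl n)) φ (a n)
        exact ⟨χ, by rintro _ ⟨⟩ _; exact h0 hφ, h⟩
    · obtain ⟨χ, -, h⟩ := hx (fun k => y k (Sum.inr i)) 0 0
      exact ⟨χ, by simp, h⟩
  choose χ hχ0 hχ using hchar
  have hext : ∀ n, ∃ f : G →+ UnitAddCircle, f.comp A.subtype = χ (Sum.inl n) := fun n =>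
    baer_unitAddCircle.extension_property_addMonoidHom A.subtype A.subtype_injective _
  choose f hf using hext
  have hf' : ∀ n (b : A), f n b = χ (Sum.inl n) b := fun n b => DFunLike.congr_fun (hf n) b
  let N : AddSubgroup G := ⨅ n, (f n).ker
  have hN : ∀ g, g ∈ N ↔ ∀ n, f n g = 0 := fun g => by
    simp [N, AddSubgroup.mem_iInf, AddMonoidHom.mem_ker]
  have hAN : Disjoint A N := by
    refine AddSubgroup.disjoint_def.mpr fun {g} hgA hgN => ?_
    obtain ⟨n, hn⟩ := ha ⟨g, hgA⟩
    by_contra h0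
    have h1 : a n ≠ 0 := fun h => h0 (by simpa [hn] using h)
    refine hχ0 _ n rfl h1 ?_
    rw [← hf', hn]
    exact (hN g).mp hgN n
  obtain ⟨ψ, hψ⟩ := hsep N hAN
  -- As `A ∩ N = 0`, the sum map `A × N → G` is injective, so `χ` on `A` and `ψ i` on `N` glue and
  -- extend to `G`.
  have hext2 : ∀ i, ∃ h : G →+ UnitAddCircle,
      (∀ b : A, h b = χ (Sum.inr i) b) ∧ ∀ c : N, h c = ψ i c := by
    intro i
    have hinj : Function.Injective (A.subtype.coprod N.subtype) := by
      refine (injective_iff_map_eq_zero _).mpr fun p hp => ?_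
      have hp' : (p.1 : G) = -(p.2 : G) := eq_neg_of_add_eq_zero_left hp
      have h1 : (p.1 : G) = 0 :=
        AddSubgroup.disjoint_def.mp hAN p.1.2 (hp' ▸ N.neg_mem p.2.2)
      refine Prod.ext (Subtype.ext h1) (Subtype.ext ?_)
      rw [h1] at hp'
      simpa using hp'
    obtain ⟨h, hh⟩ := baer_unitAddCircle.extension_property_addMonoidHom _ hinj
      ((χ (Sum.inr i)).coprod (ψ i))
    refine ⟨h, fun b => ?_, fun c => ?_⟩
    · simpa using DFunLike.congr_fun hh (b, 0)
    · simpa using DFunLike.congr_fun hh (0, c)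
  choose h hhA hhN using hext2
  let comp : ℕ ⊕ (Finset ℝ × Finset ℝ) → (G →+ UnitAddCircle) := Sum.elim f h
  have hcomp : ∀ t (b : A), comp t b = χ t b := by
    rintro (n | i) b
    · exact hf' n b
    · exact hhA i b
  refine ⟨AddMonoidHom.pi comp, (injective_iff_map_eq_zero _).mpr fun g hg => ?_, fun g => ?_⟩
  · have hgN : g ∈ N := (hN g).mpr fun n => congrFun hg (Sum.inl n)
    by_contra h0
    obtain ⟨i, hi⟩ := hψ ⟨g, hgN⟩ (fun h => h0 (congrArg Subtype.val h))
    exact hi ((hhN i ⟨g, hgN⟩).symm.trans (congrFun hg (Sum.inr i)))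
  · rw [mem_closure_iff_nhds]
    intro U hU
    rw [nhds_pi, Filter.mem_pi'] at hU
    obtain ⟨s, V, hV, hVU⟩ := hU
    have hball : ∃ ε : ℝ, 0 < ε ∧ ∀ t ∈ s, Metric.ball (comp t g) ε ⊆ V t := by
      refine (Filter.Eventually.and (self_mem_nhdsWithin : Set.Ioi (0 : ℝ) ∈ 𝓝[>] 0)
        ((Finset.eventually_all s).mpr fun t _ => ?_)).exists
      obtain ⟨r, hr0, hr⟩ := Metric.mem_nhds_iff.mp (hV t)
      filter_upwards [Ioc_mem_nhdsGT hr0] with ε hε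
      exact (Metric.ball_subset_ball hε.2).trans hr
    obtain ⟨ε, hε, hεV⟩ := hball
    have hnear := hy s (fun t => ⟨comp t g, hK _ _⟩) (ε / 2) (half_pos hε)
    have hev : ∀ᶠ n in Filter.atTop, ∀ t ∈ s,
        ‖χ t (x n) - (y n t : UnitAddCircle)‖ < ε / 2 := by
      refine (Finset.eventually_all s).mpr fun t _ => ?_
      simpa using (hχ t).norm.eventually_lt_const (u := ε / 2) (by simpa using hε)
    obtain ⟨n, hn1, hn2⟩ := (hnear.and_eventually hev).exists
    refine ⟨_, hVU fun t ht => hεV t ht ?_, Set.mem_image_of_mem _ (hxX n)⟩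
    rw [Metric.mem_ball]
    refine (dist_triangle _ (y n t : UnitAddCircle) _).trans_lt ?_
    have h1 := hn2 t ht
    have h2 := hn1 t ht
    rw [← hcomp, ← dist_eq_norm] at h1
    rw [Subtype.dist_eq] at h2
    exact (add_lt_add h1 h2).trans_eq (add_halves ε)

/-! ### The induced topology -/

theorem exists_isPrecompactHausdorffGroupTopology_dense {G H : Type*} [AddCommGroup G]
    [AddCommGroup H] [UniformSpace H] [IsUniformAddGroup H] [CompactSpace H] [T2Space H]
    {Φ : G →+ H} (hΦ : Function.Injective Φ) {X : Set G} (hX : ∀ g, Φ g ∈ closure (Φ '' X)) :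
    ∃ 𝒯 : TopologicalSpace G, IsPrecompactHausdorffGroupTopology 𝒯 ∧ @Dense G 𝒯 X := by
  let _ : TopologicalSpace G := TopologicalSpace.induced Φ inferInstance
  have hind : Topology.IsInducing Φ := ⟨rfl⟩
  have hgrp : IsTopologicalAddGroup G := topologicalAddGroup_induced Φ
  refine ⟨inferInstance, ⟨⟨hgrp, (Topology.IsEmbedding.mk hind hΦ).t2Space⟩, ?_⟩, fun g => ?_⟩
  · let _ : UniformSpace G := IsTopologicalAddGroup.rightUniformSpace G
    have : IsUniformAddGroup G := isUniformAddGroup_of_addCommGroup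
    have hu : IsUniformInducing Φ := AddMonoidHom.isUniformInducing_of_isInducing hind
    have hG : TotallyBounded (Set.univ : Set G) := by
      have := totallyBounded_preimage hu (isCompact_univ (X := H)).totallyBounded
      simpa using this
    have hr : TotallyBounded (Set.range ((↑) : G → UniformSpace.Completion G)) := by
      rw [← Set.image_univ]
      exact hG.image (UniformSpace.Completion.uniformContinuous_coe G)
    refine ⟨?_⟩
    have := hr.closure.isCompact_of_isClosed isClosed_closure
    rwa [UniformSpace.Completion.denseRange_coe.closure_range] at this
  · rw [hind.closure_eq_preimage_closure_image]
    exact hX g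

/-! ### Finiteness of torsion -/

theorem pRank_lt_aleph0_iff {G : Type*} [AddCommGroup G] {p : ℕ} (hp : p.Prime) :
    pRank G p < ℵ₀ ↔ {x : G | p • x = 0}.Finite := by
  have : Fact p.Prime := ⟨hp⟩
  let _ : Module (ZMod p) (AddSubgroup.torsionBy G (p : ℤ)) := AddSubgroup.torsionBy.zmodModule
  have hset : {x : G | p • x = 0} = (AddSubgroup.torsionBy G (p : ℤ) : Set G) := by
    ext x
    change p • x = 0 ↔ (p : ℤ) • x = 0
    rw [natCast_zsmul]
  rw [hset]
  change Module.rank (ZMod p) (AddSubgroup.torsionBy G (p : ℤ)) < ℵ₀ ↔ _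
  rw [Module.rank_lt_aleph0_iff]
  constructor
  · intro h
    have : Finite (AddSubgroup.torsionBy G (p : ℤ)) := Module.finite_of_finite (ZMod p)
    exact Set.toFinite _
  · intro h
    have : Finite (AddSubgroup.torsionBy G (p : ℤ)) := h
    infer_instance

/-- Multiplication by `p` has finite fibres, each empty or a coset of G[p], so finiteness passes
from G[a] to G[pa]. -/
theorem IsAlmostTorsionFree.finite_torsion {G : Type*} [AddCommGroup G]
    (hG : IsAlmostTorsionFree G) (n : ℕ) (hn : n ≠ 0) : {x : G | n • x = 0}.Finite := by
  induction n using induction_on_primes with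
  | zero => exact absurd rfl hn
  | one => simp
  | prime_mul p a hp ih =>
    have ha : {x : G | a • x = 0}.Finite := ih (right_ne_zero_of_mul hn)
    have hfp := (pRank_lt_aleph0_iff hp).mp (hG p hp)
    have : {x : G | (p * a) • x = 0} = (fun x => p • x) ⁻¹' {x | a • x = 0} := by
      ext x; simp [mul_comm p a, mul_smul]
    rw [this]
    refine Set.Finite.preimage' ha fun b _ => ?_
    by_cases hb : ∃ c, p • c = b
    · obtain ⟨c, rfl⟩ := hb
      refine (hfp.image (c + ·)).subset fun x hx => ⟨x - c, ?_, by simp⟩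
      simpa [smul_sub, sub_eq_zero] using hx
    · convert Set.finite_empty
      ext x
      simpa using fun h => hb ⟨x, h⟩

/-- All torsion is countable here, so it can be put into `A`; any subgroup disjoint from `A` is then
torsion-free. -/
theorem IsAlmostTorsionFree.exists_precompact_dense {G : Type*} [AddCommGroup G]
    (hc : #G ≤ 2 ^ 𝔠) (hG : IsAlmostTorsionFree G) {X : Set G} (hX : X.Infinite) :
    ∃ 𝒯 : TopologicalSpace G, IsPrecompactHausdorffGroupTopology 𝒯 ∧ @Dense G 𝒯 X := by
  have hT := hG.finite_torsion
  obtain ⟨S, hSX, hSinf, hS⟩ := hX.exists_infinite_countable_subset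
  let Tor : Set G := ⋃ n : ℕ, {x : G | (n + 1) • x = 0}
  have hTor : Tor.Countable := Set.countable_iUnion fun n => (hT _ n.succ_ne_zero).countable
  let A := AddSubgroup.closure (S ∪ Tor)
  have hAc : Countable A := AddSubgroup.countable_closure (hS.union hTor)
  have hsub : S ∪ Tor ⊆ A := AddSubgroup.subset_closure
  obtain ⟨Φ, h1, h2⟩ := exists_injective_hom_closure (K := ⊤) (fun _ _ => trivial) (X := X) (A := A)
    (isSpreading_top_of_finite_torsion fun m hm => by
      refine Set.Finite.of_injOn (f := Subtype.val) (fun x hx => ?_)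
        Subtype.val_injective.injOn (hT m hm)
      exact congrArg Subtype.val hx)
    (hSinf.mono fun s hs => ⟨hSX hs, hsub (Or.inl hs)⟩)
    fun N hN => exists_separating_family_of_torsionFree (fun n x hn hx => by
      refine Subtype.ext (AddSubgroup.disjoint_def.mp hN (hsub (Or.inr ?_)) x.2)
      refine Set.mem_iUnion.mpr ⟨n - 1, ?_⟩
      have : n - 1 + 1 = n := by omega
      change (n - 1 + 1) • (x : G) = 0
      rw [this]
      exact congrArg Subtype.val hx) ((Cardinal.mk_subtype_le _).trans hc)
  exact exists_isPrecompactHausdorffGroupTopology_dense h1 h2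

theorem exists_precompact_dense_of_prime_exponent {G : Type*} [AddCommGroup G]
    (hc : #G ≤ 2 ^ 𝔠) {p : ℕ} (hp : p.Prime) (hG : ∀ x : G, p • x = 0) {X : Set G}
    (hX : X.Infinite) :
    ∃ 𝒯 : TopologicalSpace G, IsPrecompactHausdorffGroupTopology 𝒯 ∧ @Dense G 𝒯 X := by
  obtain ⟨S, hSX, hSinf, hS⟩ := hX.exists_infinite_countable_subset
  have hAc := AddSubgroup.countable_closure hS
  have hsub : ∀ (B : AddSubgroup G) (x : B), p • x = 0 := fun B x =>
    Subtype.ext ((B.coe_nsmul x p).trans (hG x))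
  have hK : ∀ (φ : G →+ UnitAddCircle) (g : G), φ g ∈ (nsmulAddMonoidHom p).ker := fun φ g => by
    rw [AddMonoidHom.mem_ker, nsmulAddMonoidHom_apply, ← map_nsmul, hG, map_zero]
  obtain ⟨Φ, h1, h2⟩ := exists_injective_hom_closure hK
    (isSpreading_of_prime hp (hsub (AddSubgroup.closure S)))
    (hSinf.mono fun g hg => ⟨hSX hg, AddSubgroup.subset_closure hg⟩)
    fun N _ => exists_separating_family_of_prime hp (hsub N)
      ((Cardinal.mk_subtype_le _).trans hc)
  exact exists_isPrecompactHausdorffGroupTopology_dense h1 h2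

/-! ### Zariski closed sets -/

theorem IsElementaryAlgebraic.isClosed {G : Type*} [AddCommGroup G] [TopologicalSpace G]
    [IsTopologicalAddGroup G] [T2Space G] {E : Set G} (hE : IsElementaryAlgebraic E) :
    IsClosed E := by
  obtain ⟨g, n, rfl⟩ := hE
  refine (Homeomorph.addLeft g).isClosedMap _ ?_
  exact isClosed_eq (continuous_const_smul n) continuous_const

theorem IsAlgebraicSet.isClosed {G : Type*} [AddCommGroup G] [TopologicalSpace G]
    [IsTopologicalAddGroup G] [T2Space G] {S : Set G} (hS : IsAlgebraicSet S) :
    IsClosed S := by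
  obtain ⟨𝓐, h𝓐, rfl⟩ := hS
  refine isClosed_sInter fun A hA => ?_
  obtain ⟨𝓔, hfin, hE, rfl⟩ := h𝓐 A hA
  rw [Set.sUnion_eq_biUnion]
  exact hfin.isClosed_biUnion fun E h => (hE E h).isClosed

theorem isAlgebraicSet_torsion {G : Type*} [AddCommGroup G] (n : ℕ) :
    IsAlgebraicSet {x : G | n • x = 0} := by
  refine ⟨{{x : G | n • x = 0}}, ?_, by simp⟩
  rintro A rfl
  refine ⟨{{x : G | n • x = 0}}, Set.finite_singleton _, ?_, by simp⟩
  rintro E rfl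
  exact ⟨0, n, by simp⟩

theorem mainTheorem9 {G : Type*} [AddCommGroup G] (hG : #G ≤ 2 ^ 𝔠) :
    [∀ X : Set G, X.Infinite → PotentiallyDense X,
      ∀ X : Set G, X.Infinite →
        ∃ 𝒯 : TopologicalSpace G, IsPrecompactHausdorffGroupTopology 𝒯 ∧ @Dense G 𝒯 X,
      IsAlmostTorsionFree G ∨ ∃ p : ℕ, p.Prime ∧ AddMonoid.exponent G = p,
      ∀ S : Set G, IsClosed[zariskiTopology G] S → S ≠ Set.univ → S.Finite].TFAE := by
  tfae_have 2 → 1 := fun h X hX => by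
    obtain ⟨𝒯, h𝒯, hd⟩ := h X hX
    exact ⟨𝒯, h𝒯.toIsHausdorffGroupTopology, hd⟩
  tfae_have 1 → 4 := fun h S hS hne => by
    by_contra hinf
    obtain ⟨𝒯, ⟨_, _⟩, hd⟩ := h S hinf
    have hcl := ((isClosed_zariskiTopology_iff S).mp hS).isClosed
    exact hne (hcl.closure_eq ▸ hd.closure_eq)
  tfae_have 4 → 3 := fun h => by
    by_contra hn
    simp only [IsAlmostTorsionFree, not_or, not_forall] at hn
    obtain ⟨⟨p, hp, hr⟩, hexp⟩ := hn
    -- G[p] is Zariski closed and infinite, hence all of `G`; the exponent is then `p`, as exponent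
    -- 1 would make `G` trivial.
    have huniv : {x : G | p • x = 0} = Set.univ := by
      by_contra hne
      exact hr ((pRank_lt_aleph0_iff hp).mpr
        (h _ ((isClosed_zariskiTopology_iff _).mpr (isAlgebraicSet_torsion p)) hne))
    have hdvd : AddMonoid.exponent G ∣ p :=
      AddMonoid.exponent_dvd_of_forall_nsmul_eq_zero fun x => huniv.ge (Set.mem_univ x)
    rcases (Nat.dvd_prime hp).mp hdvd with h1 | h1
    · have := AddMonoid.exp_eq_one_iff.mp h1
      exact hr ((pRank_lt_aleph0_iff hp).mpr (Set.toFinite _))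
    · exact hexp ⟨p, hp, h1⟩
  tfae_have 3 → 2 := by
    rintro (h | ⟨p, hp, h⟩) X hX
    · exact h.exists_precompact_dense hG hX
    · exact exists_precompact_dense_of_prime_exponent hG hp
        (fun x => h ▸ AddMonoid.exponent_nsmul_eq_zero x) hX
  tfae_finish
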